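/- Let $K$ be a field of characteristic $0$ (for instance $K=\mathbb{C}$). A labelled multigraph is a pair $G=([n],E(G))$ with $n\ge 0$, $[n]=\{1,\dots,n\}$, and $E(G)$ a finite multiset of unordered pairs $uv$ of not necessarily distinct elements of $[n]$ (loops and multi-edges are allowed). Two labelled multigraphs $G$, $H$ are isomorphic if there is a bijection $f$ between their vertex sets such that for all vertices $u,v$ of $G$ (possibly equal) the multiplicity of $uv$ in $E(G)$ equals that of $f(u)f(v)$ in $E(H)$. Let $\mathbb{G}[t]$ be the free $K[t]$-module on the set of all labelled multigraphs. Let $\Lambda[t]$ be the algebra of symmetric functions with coefficients in $K[t]$, i.e. of formal power series of bounded degree in $x_1,x_2,\dots$ over $K[t]$ that are invariant under all permutations of the variables. Let $XB:\mathbb{G}[t]\to\Lambda[t]$ be the $K[t]$-linear map that sends a labelled multigraph $G$ to its Tutte symmetric function $$XB_G=\sum_{\kappa:V(G)\to\{1,2,\dots\}}(1+t)^{e(\kappa)}\prod_{v\in V(G)}x_{\kappa(v)},$$ where $\kappa$ runs over all (not necessarily proper) colorings and $e(\kappa)$ is the number of edges of $G$, counted with multiplicity, whose endpoints receive the same color.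 For a $K[t]$-linear combination $L=\sum_i c_iH_i$ of multigraphs $H_i$ with the same vertex set $[n]$, and a multigraph $G$ with vertex set $[N]$, $N\ge n$, put $Ext(L;G)=\sum_i c_i\,(G\uplus E(H_i))$, where $G\uplus E(H_i)$ is the multigraph on $[N]$ whose edge multiset is the multiset sum of $E(G)$ and $E(H_i)$ (multiplicities are added). Writing a multigraph on a given $[n]$ as its edge multiset, define $$\ell_{loop}=\{11\}-(t+1)\,\emptyset\quad(n=1),$$ $$\ell_{multi}=\{12,12\}-(t+2)\{12\}+(t+1)\,\emptyset\quad(n=2),$$ $$\ell_{os+}=\{12,23\}+\{13\}-\{12\}-\{13,23\}\quad(n=3).$$ Let $T_{iso}$ be the set of all $G-H$ with $G$ and $H$ isomorphic labelled multigraphs. Let $T_{loop}$, $T_{multi}$, $T_{os+}$ be the sets of all extensions $Ext(\ell_{loop};G)$, $Ext(\ell_{multi};G)$, $Ext(\ell_{os+};G)$ respectively, over all $G$ with at least $1$, $2$, $3$ vertices respectively. Let $I$, $S_1$, $S_2$ be the sets of all $K[t]$-linear combinations of elements of $T_{iso}$, of $T_{loop}\cup T_{multi}$, and of $T_{os+}$,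 respectively. Then $$\operatorname{Span}(I,S_1,S_2)=\operatorname{Ker}(XB).$$ -/

import Mathlib

open Polynomial

noncomputable section

/-! ### Symmetric functions -/

/-- The algebra of symmetric functions in the variables `x_0, x_1, x_2, …` over `R`: the formal
power series that are invariant under all permutations of the variables and have bounded degree.
For `R = K[X]` this is `Λ[t]`, the polynomial variable `X` playing the role of `t`. -/
def SymFun (R : Type*) [CommRing R] : Subalgebra R (MvPowerSeries ℕ R) where
  carrier := {f | (∀ σ : Equiv.Perm ℕ, MvPowerSeries.renameEquiv R σ f = f) ∧
    ∃ d : ℕ, ∀ m : ℕ →₀ ℕ, d < m.degree → MvPowerSeries.coeff m f = 0}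
  mul_mem' := by
    rintro f g ⟨hf, d, hd⟩ ⟨hg, e, he⟩
    refine ⟨fun σ => by rw [map_mul, hf, hg], d + e, fun m hm => ?_⟩
    classical
    rw [MvPowerSeries.coeff_mul]
    refine Finset.sum_eq_zero fun p hp => ?_
    rw [Finset.HasAntidiagonal.mem_antidiagonal] at hp
    rw [← hp, map_add] at hm
    by_cases h : d < p.1.degree
    · rw [hd _ h, zero_mul]
    · rw [he _ (by omega), mul_zero]
  add_mem' := by
    rintro f g ⟨hf, d, hd⟩ ⟨hg, e, he⟩
    refine ⟨fun σ => by rw [map_add, hf, hg], max d e, fun m hm => ?_⟩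
    rw [map_add, hd m (lt_of_le_of_lt (le_max_left _ _) hm),
      he m (lt_of_le_of_lt (le_max_right _ _) hm), add_zero]
  algebraMap_mem' := by
    intro r
    refine ⟨fun σ => AlgEquiv.commutes _ r, 0, fun m hm => ?_⟩
    classical
    have hm0 : m ≠ 0 := by
      rintro rfl
      simp at hm
    rw [MvPowerSeries.algebraMap_apply, MvPowerSeries.coeff_C, if_neg hm0]

/-! ### Labelled multigraphs -/

/-- A multigraph with vertex set `Fin n` (the labels `1, …, n` are shifted to `0, …, n - 1`) is
given by its multiset of edges; loops and multi-edges are allowed. -/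
abbrev EdgeMultiset (n : ℕ) : Type := Multiset (Sym2 (Fin n))

/-- A labelled multigraph, with vertex set `Fin order` for some natural number `order`. -/
structure LabelledGraph where
  /-- the number of vertices -/
  order : ℕ
  /-- the multiset of edges -/
  edges : EdgeMultiset order

/-- Isomorphism of multigraphs: a bijection of the vertices preserving the number of edges between
any two (not necessarily distinct) vertices. -/
def LabelledGraph.Isomorphic (G H : LabelledGraph) : Prop :=
  ∃ f : Fin G.order ≃ Fin H.order, ∀ u v : Fin G.order,
    G.edges.count s(u, v) = H.edges.count s(f u, f v)

/-- `𝔾[t]`: formal linear combinations of labelled multigraphs with coefficients in `K[t]`. -/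
abbrev GraphAlgebra (K : Type*) [Field K] : Type _ := LabelledGraph →₀ K[X]

/-! ### The Tutte symmetric function -/

/-- `e(κ)`: the number of edges, with multiplicity, whose endpoints get the same color. -/
def LabelledGraph.badEdges (G : LabelledGraph) (κ : Fin G.order → ℕ) : ℕ :=
  G.edges.countP fun e => (e.map κ).IsDiag

/-- The exponent vector of the monomial `∏ v, x_{κ v}` of a coloring `κ`. -/
def colorWeight {n : ℕ} (κ : Fin n → ℕ) : ℕ →₀ ℕ := ∑ v, Finsupp.single (κ v) 1

/-- The finitely many colorings `κ` whose monomial `∏ v, x_{κ v}` is `x ^ m`. -/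
def coloringsOf (n : ℕ) (m : ℕ →₀ ℕ) : Finset (Fin n → ℕ) :=
  (Fintype.piFinset fun _ => m.support).filter fun κ => colorWeight κ = m

theorem mem_coloringsOf {n : ℕ} {m : ℕ →₀ ℕ} {κ : Fin n → ℕ} :
    κ ∈ coloringsOf n m ↔ colorWeight κ = m := by
  rw [coloringsOf, Finset.mem_filter, and_iff_right_iff_imp]
  rintro rfl
  rw [Fintype.mem_piFinset]
  intro v
  rw [Finsupp.mem_support_iff, colorWeight, Finsupp.finsetSum_apply]
  intro h
  have := (Finset.sum_eq_zero_iff.mp h) v (Finset.mem_univ v)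
  simp at this

/-- `XB_G = ∑ κ, (1 + t) ^ e(κ) * ∏ v, x_{κ v}`, the sum over all colorings `κ`, as a formal power
series: the coefficient of `x ^ m` is the sum of `(1 + t) ^ e(κ)` over the colorings with monomial
`x ^ m`. -/
def LabelledGraph.xbSeries (K : Type*) [Field K] (G : LabelledGraph) : MvPowerSeries ℕ K[X] :=
  fun m => ∑ κ ∈ coloringsOf G.order m, (1 + X) ^ G.badEdges κ

theorem LabelledGraph.coeff_xbSeries (K : Type*) [Field K] (G : LabelledGraph) (m : ℕ →₀ ℕ) :
    MvPowerSeries.coeff m (G.xbSeries K) =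
      ∑ κ ∈ coloringsOf G.order m, (1 + X) ^ G.badEdges κ := rfl

theorem colorWeight_comp {n : ℕ} (σ : Equiv.Perm ℕ) (κ : Fin n → ℕ) :
    colorWeight (σ ∘ κ) = Finsupp.embDomain σ.toEmbedding (colorWeight κ) := by
  rw [Finsupp.embDomain_eq_mapDomain, colorWeight, colorWeight, Finsupp.mapDomain_finsetSum]
  simp

theorem LabelledGraph.badEdges_comp (G : LabelledGraph) (σ : Equiv.Perm ℕ)
    (κ : Fin G.order → ℕ) : G.badEdges (σ ∘ κ) = G.badEdges κ := by
  unfold LabelledGraph.badEdges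
  refine Multiset.countP_congr rfl fun e _ => ?_
  induction e with
  | _ a b => simp

theorem LabelledGraph.xbSeries_mem (K : Type*) [Field K] (G : LabelledGraph) :
    G.xbSeries K ∈ SymFun K[X] := by
  refine ⟨fun σ => ?_, G.order, fun m hm => ?_⟩
  · ext1 m
    obtain ⟨m, rfl⟩ : ∃ m' : ℕ →₀ ℕ, Finsupp.embDomain σ.toEmbedding m' = m :=
      ⟨Finsupp.embDomain σ.symm.toEmbedding m, by
        rw [Finsupp.embDomain_eq_mapDomain, Finsupp.embDomain_eq_mapDomain,
          ← Finsupp.mapDomain_comp]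
        simp⟩
    have h : MvPowerSeries.renameEquiv K[X] σ (G.xbSeries K) =
        MvPowerSeries.rename σ.toEmbedding (G.xbSeries K) := rfl
    rw [h, MvPowerSeries.coeff_embDomain_rename, G.coeff_xbSeries K, G.coeff_xbSeries K]
    refine Finset.sum_bij' (fun κ _ => σ ∘ κ) (fun κ _ => σ.symm ∘ κ) ?_ ?_ ?_ ?_ ?_
    · intro κ hκ
      rw [mem_coloringsOf] at hκ ⊢
      rw [colorWeight_comp, hκ]
    · intro κ hκ
      rw [mem_coloringsOf] at hκ ⊢
      apply Finsupp.embDomain_injective σ.toEmbedding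
      rw [← colorWeight_comp, ← hκ]
      congr 1
      ext v
      simp
    · intro κ _
      ext v
      simp
    · intro κ _
      ext v
      simp
    · intro κ _
      rw [G.badEdges_comp]
  · rw [G.coeff_xbSeries K]
    refine Finset.sum_eq_zero fun κ hκ => ?_
    rw [mem_coloringsOf] at hκ
    rw [← hκ, colorWeight, map_sum] at hm
    simp at hm

/-- The Tutte symmetric function of a labelled multigraph, as an element of `Λ[t]`. -/
def LabelledGraph.tutteSymFun (K : Type*) [Field K] (G : LabelledGraph) : SymFun K[X] :=
  ⟨G.xbSeries K, G.xbSeries_mem K⟩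

/-- The map `XB : 𝔾[t] → Λ[t]`, the `K[t]`-linear extension of `G ↦ XB_G`. -/
def XB (K : Type*) [Field K] : GraphAlgebra K →ₗ[K[X]] SymFun K[X] :=
  Finsupp.linearCombination K[X] (LabelledGraph.tutteSymFun K)

/-! ### Extensions and the generating relations -/

/-- `G ⊎ E(H)` for a graph `G` on `Fin N` and a graph `H` on `Fin n` with `n ≤ N`; the vertices of
`H` are the first `n` vertices of `G`. -/
def LabelledGraph.addEdges (G : LabelledGraph) {n : ℕ} (h : n ≤ G.order) (H : EdgeMultiset n) :
    LabelledGraph :=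
  ⟨G.order, G.edges + H.map (Sym2.map (Fin.castLE h))⟩

/-- `Ext(L; G)`: replace every graph `H` in the linear combination `L` of graphs with vertex set
`Fin n` by `G ⊎ E(H)`. -/
def extension {K : Type*} [Field K] {n : ℕ} (L : EdgeMultiset n →₀ K[X]) (G : LabelledGraph)
    (h : n ≤ G.order) : GraphAlgebra K :=
  Finsupp.mapDomain (G.addEdges h) L

/-- All extensions of `L` by graphs with at least as many vertices. -/
def extensions {K : Type*} [Field K] {n : ℕ} (L : EdgeMultiset n →₀ K[X]) :
    Set (GraphAlgebra K) :=
  {x | ∃ (G : LabelledGraph) (h : n ≤ G.order), x = extension L G h}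

/-- `ℓ_loop = {11} - (t + 1) ∅` on one vertex. -/
def ellLoop (K : Type*) [Field K] : EdgeMultiset 1 →₀ K[X] :=
  Finsupp.single {s(0, 0)} 1 - Finsupp.single 0 (X + 1)

/-- `ℓ_multi = {12, 12} - (t + 2) {12} + (t + 1) ∅` on two vertices. -/
def ellMulti (K : Type*) [Field K] : EdgeMultiset 2 →₀ K[X] :=
  Finsupp.single {s(0, 1), s(0, 1)} 1 - Finsupp.single {s(0, 1)} (X + 2)
    + Finsupp.single 0 (X + 1)

/-- `ℓ_os+ = {12, 23} + {13} - {12} - {13, 23}` on three vertices: with `G = {12, 23}` this is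
`G + Gᶜ - G \ 23 - (G \ 23)ᶜ`. -/
def ellOSPlus (K : Type*) [Field K] : EdgeMultiset 3 →₀ K[X] :=
  Finsupp.single {s(0, 1), s(1, 2)} 1 + Finsupp.single {s(0, 2)} 1
    - Finsupp.single {s(0, 1)} 1 - Finsupp.single {s(0, 2), s(1, 2)} 1

/-- `T_iso`: all differences `G - H` of isomorphic labelled graphs. -/
def TIso (K : Type*) [Field K] : Set (GraphAlgebra K) :=
  {x | ∃ G H : LabelledGraph, G.Isomorphic H ∧ x = Finsupp.single G 1 - Finsupp.single H 1}

/-- `T_loop`. -/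
def TLoop (K : Type*) [Field K] : Set (GraphAlgebra K) := extensions (ellLoop K)

/-- `T_multi`. -/
def TMulti (K : Type*) [Field K] : Set (GraphAlgebra K) := extensions (ellMulti K)

/-- `T_os+`. -/
def TOSPlus (K : Type*) [Field K] : Set (GraphAlgebra K) := extensions (ellOSPlus K)

end

/-! ### Isomorphisms and recolorings -/

/-! The relations lie in the kernel because each of them already cancels coloring by coloring
(`extension_mem_ker`).

For the converse, star forests serve as normal forms. Modulo the relations, loops and repeated edges
reduce the number of edges. In a simple graph that is not a star forest, some edge vw has no
endpoint of degree one; if v is the endpoint of smaller degree, the `os+` relation trades an edge uv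
for uw, up to graphs with fewer edges. This raises the sum of squared degrees, which is bounded, so
the process ends (`single_mem_starForestSpan`), and isomorphic star forests can be merged
(`exists_sub_mem_relationSpan`).

It remains to see that non-isomorphic star forests have K[t]-independent images
(`eq_zero_of_mem_ker`). Every coefficient of XB_G has t-degree at most |E(G)|, and its coefficient
at that degree counts the colorings constant on each star. In a vanishing combination, take H
maximizing first the total t-degree and then the number of stars, and look at the monomial recording
the star sizes of H. By `isomorphic_of_monochromatic` only H contributes in top degree, with a
positive integer factor, which is nonzero in characteristic 0. -/

theorem LabelledGraph.Isomorphic.exists_edges_eq {G H : LabelledGraph} (h : G.Isomorphic H) :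
    ∃ f : Fin G.order ≃ Fin H.order, H.edges = G.edges.map (Sym2.map f) := by
  obtain ⟨f, hf⟩ := h
  refine ⟨f, Multiset.ext' fun e => ?_⟩
  induction e with
  | _ a b =>
    obtain ⟨u, rfl⟩ := f.surjective a
    obtain ⟨v, rfl⟩ := f.surjective b
    rw [← hf, ← Sym2.map_mk, Multiset.count_map_eq_count' _ _ (Sym2.map.injective f.injective)]

theorem LabelledGraph.isomorphic_map {m n : ℕ} (E : EdgeMultiset m) (f : Fin m ≃ Fin n) :
    LabelledGraph.Isomorphic ⟨m, E⟩ ⟨n, E.map (Sym2.map f)⟩ := by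
  refine ⟨f, fun u v => ?_⟩
  rw [← Sym2.map_mk, Multiset.count_map_eq_count' _ _ (Sym2.map.injective f.injective)]

/-- The number of edges of a multigraph, counted with multiplicity, that a coloring makes
monochromatic. -/
def monoCount {n : ℕ} (E : EdgeMultiset n) (κ : Fin n → ℕ) : ℕ :=
  E.countP fun e => (e.map κ).IsDiag

theorem badEdges_eq_monoCount (G : LabelledGraph) (κ : Fin G.order → ℕ) :
    G.badEdges κ = monoCount G.edges κ := rfl

theorem monoCount_add {n : ℕ} (E F : EdgeMultiset n) (κ : Fin n → ℕ) :
    monoCount (E + F) κ = monoCount E κ + monoCount F κ :=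
  Multiset.countP_add _ _ _

theorem monoCount_map {m n : ℕ} (E : EdgeMultiset m) (f : Fin m → Fin n) (κ : Fin n → ℕ) :
    monoCount (E.map (Sym2.map f)) κ = monoCount E (κ ∘ f) := by
  unfold monoCount
  rw [Multiset.countP_map, Multiset.countP_eq_card_filter]
  congr 1
  refine Multiset.filter_congr fun e _ => ?_
  rw [Sym2.map_map]

theorem colorWeight_comp_equiv {m n : ℕ} (f : Fin m ≃ Fin n) (κ : Fin n → ℕ) :
    colorWeight (κ ∘ f) = colorWeight κ :=
  Equiv.sum_comp f fun v => Finsupp.single (κ v) 1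

theorem LabelledGraph.Isomorphic.xbSeries_eq (K : Type*) [Field K] {G H : LabelledGraph}
    (h : G.Isomorphic H) : G.xbSeries K = H.xbSeries K := by
  obtain ⟨f, hf⟩ := h.exists_edges_eq
  ext1 m
  rw [coeff_xbSeries, coeff_xbSeries]
  refine Finset.sum_bij' (fun κ _ => κ ∘ f.symm) (fun κ _ => κ ∘ f) ?_ ?_ ?_ ?_ ?_
  · intro κ hκ
    rw [mem_coloringsOf] at hκ ⊢
    rw [colorWeight_comp_equiv, hκ]
  · intro κ hκ
    rw [mem_coloringsOf] at hκ ⊢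
    rw [colorWeight_comp_equiv, hκ]
  · intro κ _
    ext v
    simp
  · intro κ _
    ext v
    simp
  · intro κ _
    rw [badEdges_eq_monoCount, badEdges_eq_monoCount, hf, monoCount_map]
    congr 2
    ext v
    simp

/-! ### The relations lie in the kernel -/

theorem coeff_XB (K : Type*) [Field K] (x : GraphAlgebra K) (m : ℕ →₀ ℕ) :
    MvPowerSeries.coeff m (XB K x : MvPowerSeries ℕ K[X]) =
      x.sum fun G c => c * MvPowerSeries.coeff m (G.xbSeries K) := by
  rw [XB, Finsupp.linearCombination_apply, Finsupp.sum, Finsupp.sum, AddSubmonoidClass.coe_finsetSum,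
    map_sum]
  rfl

theorem mem_ker_XB_iff {K : Type*} [Field K] {x : GraphAlgebra K} :
    x ∈ LinearMap.ker (XB K) ↔
      ∀ m, (x.sum fun G c => c * MvPowerSeries.coeff m (G.xbSeries K)) = 0 := by
  rw [LinearMap.mem_ker, Subtype.ext_iff, MvPowerSeries.ext_iff]
  simp only [coeff_XB]
  rfl

/-- For a fixed coloring the weight is multiplicative in the edges, so the factor from `G` pulls out
and only the restriction of the coloring to the first `n` vertices matters. -/
theorem extension_mem_ker {K : Type*} [Field K] {n : ℕ} {L : EdgeMultiset n →₀ K[X]}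
    (hL : ∀ κ : Fin n → ℕ, (L.sum fun H c => c * (1 + X) ^ monoCount H κ) = 0)
    (G : LabelledGraph) (h : n ≤ G.order) : extension L G h ∈ LinearMap.ker (XB K) := by
  rw [mem_ker_XB_iff]
  intro m
  rw [extension, Finsupp.sum_mapDomain_index (by simp) (by intros; ring)]
  simp only [LabelledGraph.coeff_xbSeries, Finset.mul_sum]
  change ∑ F ∈ L.support, ∑ κ ∈ coloringsOf G.order m,
    L F * (1 + X) ^ monoCount (G.edges + F.map (Sym2.map (Fin.castLE h))) κ = 0
  rw [Finset.sum_comm]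
  refine Finset.sum_eq_zero fun κ _ => ?_
  have := congrArg ((1 + X) ^ monoCount G.edges κ * ·) (hL (κ ∘ Fin.castLE h))
  simp only [mul_zero, Finsupp.sum, Finset.mul_sum] at this
  rw [← this]
  refine Finset.sum_congr rfl fun H _ => ?_
  rw [monoCount_add, monoCount_map]
  ring

theorem extensions_subset_ker {K : Type*} [Field K] {n : ℕ} {L : EdgeMultiset n →₀ K[X]}
    (hL : ∀ κ : Fin n → ℕ, (L.sum fun H c => c * (1 + X) ^ monoCount H κ) = 0) :
    extensions L ⊆ LinearMap.ker (XB K) := by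
  rintro _ ⟨G, h, rfl⟩
  exact extension_mem_ker hL G h

/-- The linear functional sending a multigraph to its weight under a fixed coloring. -/
noncomputable def coloringFunctional (K : Type*) [Field K] {n : ℕ} (κ : Fin n → ℕ) :
    (EdgeMultiset n →₀ K[X]) →ₗ[K[X]] K[X] :=
  Finsupp.linearCombination K[X] fun H => (1 + X) ^ monoCount H κ

theorem monoCount_zero {n : ℕ} (κ : Fin n → ℕ) : monoCount 0 κ = 0 := rfl

theorem monoCount_singleton {n : ℕ} (u v : Fin n) (κ : Fin n → ℕ) :
    monoCount {s(u, v)} κ = if κ u = κ v then 1 else 0 := by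
  simp [monoCount, Multiset.countP_eq_card_filter, Multiset.filter_singleton, apply_ite]

theorem monoCount_pair {n : ℕ} (u v w x : Fin n) (κ : Fin n → ℕ) :
    monoCount {s(u, v), s(w, x)} κ =
      (if κ u = κ v then 1 else 0) + if κ w = κ x then 1 else 0 := by
  rw [← monoCount_singleton, ← monoCount_singleton, ← monoCount_add]
  rfl

theorem TLoop_subset_ker (K : Type*) [Field K] :
    TLoop K ⊆ LinearMap.ker (XB K) := by
  refine extensions_subset_ker fun κ => ?_
  change coloringFunctional K κ (ellLoop K) = 0
  simp only [ellLoop, map_sub, coloringFunctional, Finsupp.linearCombination_single,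
    monoCount_zero, monoCount_singleton, smul_eq_mul, if_true]
  ring

theorem TMulti_subset_ker (K : Type*) [Field K] :
    TMulti K ⊆ LinearMap.ker (XB K) := by
  refine extensions_subset_ker fun κ => ?_
  change coloringFunctional K κ (ellMulti K) = 0
  simp only [ellMulti, map_sub, map_add, coloringFunctional, Finsupp.linearCombination_single,
    monoCount_zero, monoCount_singleton, monoCount_pair, smul_eq_mul]
  split_ifs <;> ring

theorem TOSPlus_subset_ker (K : Type*) [Field K] :
    TOSPlus K ⊆ LinearMap.ker (XB K) := by
  refine extensions_subset_ker fun κ => ?_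
  change coloringFunctional K κ (ellOSPlus K) = 0
  simp only [ellOSPlus, map_sub, map_add, coloringFunctional, Finsupp.linearCombination_single,
    monoCount_singleton, monoCount_pair, smul_eq_mul]
  -- Equality of colors is transitive: `omega` discards the patterns where exactly two of the three
  -- equalities hold.
  split_ifs <;> first | omega | ring

theorem TIso_subset_ker (K : Type*) [Field K] :
    TIso K ⊆ LinearMap.ker (XB K) := by
  rintro _ ⟨G, H, h, rfl⟩
  simp only [SetLike.mem_coe, LinearMap.mem_ker, map_sub, XB, Finsupp.linearCombination_single,
    one_smul, sub_eq_zero]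
  exact Subtype.ext (h.xbSeries_eq K)

/-! ### The span of the relations -/

/-- The span of all isomorphism, loop, multi-edge and `os+` relations. -/
noncomputable def relationSpan (K : Type*) [Field K] : Submodule K[X] (GraphAlgebra K) :=
  Submodule.span K[X] (TIso K) ⊔ Submodule.span K[X] (TLoop K ∪ TMulti K) ⊔
      Submodule.span K[X] (TOSPlus K)

theorem relationSpan_le_ker (K : Type*) [Field K] : relationSpan K ≤ LinearMap.ker (XB K) :=
  sup_le (sup_le (Submodule.span_le.2 (TIso_subset_ker K))
    (Submodule.span_le.2 (Set.union_subset (TLoop_subset_ker K) (TMulti_subset_ker K))))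
    (Submodule.span_le.2 (TOSPlus_subset_ker K))

section

variable {K : Type*} [Field K]

theorem single_sub_single_mem_relationSpan {G H : LabelledGraph} (h : G.Isomorphic H) (c : K[X]) :
    (Finsupp.single G c - Finsupp.single H c : GraphAlgebra K) ∈ relationSpan K := by
  have : (Finsupp.single G 1 - Finsupp.single H 1 : GraphAlgebra K) ∈ relationSpan K :=
    Submodule.mem_sup_left (Submodule.mem_sup_left (Submodule.subset_span ⟨G, H, h, rfl⟩))
  simpa [smul_sub] using (relationSpan K).smul_mem c this

theorem TLoop_subset_relationSpan : TLoop K ⊆ relationSpan K := fun _ hx =>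
  Submodule.mem_sup_left (Submodule.mem_sup_right (Submodule.subset_span (Or.inl hx)))

theorem TMulti_subset_relationSpan : TMulti K ⊆ relationSpan K := fun _ hx =>
  Submodule.mem_sup_left (Submodule.mem_sup_right (Submodule.subset_span (Or.inr hx)))

theorem TOSPlus_subset_relationSpan : TOSPlus K ⊆ relationSpan K := fun _ hx =>
  Submodule.mem_sup_right (Submodule.subset_span hx)

/-- Relations may be placed at arbitrary distinct vertices. -/
theorem mapDomain_mem_relationSpan {m n : ℕ} {L : EdgeMultiset m →₀ K[X]}
    (hL : extensions L ⊆ relationSpan K) (φ : Fin m → Fin n) (hφ : φ.Injective)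
    (E : EdgeMultiset n) :
    Finsupp.mapDomain (fun F : EdgeMultiset m => LabelledGraph.mk n (E + F.map (Sym2.map φ))) L ∈
      relationSpan K := by
  have h : m ≤ n := by simpa using Fintype.card_le_of_injective φ hφ
  obtain ⟨σ, hσ⟩ := Equiv.Perm.exists_extending_pair (Fin.castLE h) φ (Fin.castLE_injective h) hφ
  -- Relabelling by `σ.symm` moves the image of `φ` to the first `m` vertices, where extensions
  -- live.
  let G : LabelledGraph := ⟨n, E.map (Sym2.map σ.symm)⟩
  have hG : extension L G h ∈ relationSpan K := hL ⟨G, h, rfl⟩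
  rw [← sub_add_cancel (Finsupp.mapDomain _ L) (extension L G h)]
  refine add_mem ?_ hG
  rw [extension, Finsupp.mapDomain, Finsupp.mapDomain, Finsupp.sum, Finsupp.sum,
    ← Finset.sum_sub_distrib]
  refine sum_mem fun F _ => single_sub_single_mem_relationSpan ?_ _
  convert LabelledGraph.isomorphic_map _ σ.symm using 1
  rw [LabelledGraph.addEdges, Multiset.map_add, Multiset.map_map]
  congr 2
  refine Multiset.map_congr rfl fun e _ => ?_
  rw [Function.comp_apply, Sym2.map_map]
  congr 1
  ext v
  simp [← hσ]

theorem loop_mem_relationSpan {n : ℕ} (E : EdgeMultiset n) (v : Fin n) :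
    (Finsupp.single ⟨n, E + {s(v, v)}⟩ 1 - Finsupp.single ⟨n, E⟩ (X + 1) : GraphAlgebra K) ∈
      relationSpan K := by
  have := mapDomain_mem_relationSpan (K := K) TLoop_subset_relationSpan ![v]
    (Function.injective_of_subsingleton _) E
  simpa [ellLoop, sub_eq_add_neg, Finsupp.mapDomain_add, Finsupp.mapDomain_single,
    ← Finsupp.single_neg] using this

theorem multi_mem_relationSpan {n : ℕ} (E : EdgeMultiset n) {u v : Fin n} (h : u ≠ v) :
    (Finsupp.single ⟨n, E + {s(u, v), s(u, v)}⟩ 1 - Finsupp.single ⟨n, E + {s(u, v)}⟩ (X + 2) +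
      Finsupp.single ⟨n, E⟩ (X + 1) : GraphAlgebra K) ∈ relationSpan K := by
  have := mapDomain_mem_relationSpan (K := K) TMulti_subset_relationSpan ![u, v]
    (by intro i j; fin_cases i <;> fin_cases j <;> simp [h, h.symm]) E
  simpa [ellMulti, sub_eq_add_neg, Finsupp.mapDomain_add, Finsupp.mapDomain_single,
    ← Finsupp.single_neg] using this

theorem slide_mem_relationSpan {n : ℕ} (E : EdgeMultiset n) {u v w : Fin n} (huv : u ≠ v)
    (hvw : v ≠ w) (huw : u ≠ w) :
    (Finsupp.single ⟨n, E + {s(u, v), s(v, w)}⟩ 1 + Finsupp.single ⟨n, E + {s(u, w)}⟩ 1 -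
      Finsupp.single ⟨n, E + {s(u, v)}⟩ 1 - Finsupp.single ⟨n, E + {s(u, w), s(v, w)}⟩ 1 :
        GraphAlgebra K) ∈ relationSpan K := by
  have := mapDomain_mem_relationSpan (K := K) TOSPlus_subset_relationSpan ![u, v, w]
    (by intro i j; fin_cases i <;> fin_cases j <;>
          simp [huv, hvw, huw, huv.symm, hvw.symm, huw.symm]) E
  simpa [ellOSPlus, sub_eq_add_neg, Finsupp.mapDomain_add, Finsupp.mapDomain_single,
    ← Finsupp.single_neg] using this

end

/-! ### Star forests -/

/-- A star forest: there is an idempotent map `r` sending each vertex to the centre of its star,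
and the edges join each vertex that is not a centre to its centre. -/
def IsStarForest (G : LabelledGraph) : Prop :=
  ∃ r : Fin G.order → Fin G.order, (∀ v, r (r v) = r v) ∧
    G.edges = (Finset.univ.filter fun v => r v ≠ v).val.map fun v => s(v, r v)

/-- A simple graph in which every edge has an endpoint of degree one is a star forest. -/
theorem isStarForest_of_leaves {n : ℕ} {E : EdgeMultiset n} (hE : E.Nodup)
    (hloop : ∀ e ∈ E, ¬ e.IsDiag) (hleaf : ∀ e ∈ E, ∃ v ∈ e, ∀ f ∈ E, v ∈ f → f = e) :
    IsStarForest ⟨n, E⟩ := by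
  have h : ∀ e : Sym2 (Fin n), ∃ v ∈ e, e ∈ E → ∀ f ∈ E, v ∈ f → f = e := by
    intro e
    by_cases he : e ∈ E
    · obtain ⟨v, hv, h⟩ := hleaf e he
      exact ⟨v, hv, fun _ => h⟩
    · induction e with
      | _ a b => exact ⟨a, Sym2.mem_mk_left a b, fun h => absurd h he⟩
  choose l hl hl' using h
  -- A vertex is sent along the edge of which it is the chosen leaf; all other vertices are centres.
  -- Choosing one leaf per edge settles isolated edges.
  have h : ∀ v, ∃ w, (s(v, w) ∈ E ∧ l s(v, w) = v) ∨ ((∀ e ∈ E, l e ≠ v) ∧ w = v) := by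
    intro v
    by_cases hv : ∃ e ∈ E, l e = v
    · obtain ⟨e, he, rfl⟩ := hv
      obtain ⟨w, hw⟩ := hl e
      refine ⟨w, Or.inl ?_⟩
      rw [← hw]
      exact ⟨he, rfl⟩
    · push Not at hv
      exact ⟨v, Or.inr ⟨hv, rfl⟩⟩
  choose r hr using h
  have hne : ∀ v, r v ≠ v → s(v, r v) ∈ E ∧ l s(v, r v) = v := fun v hv =>
    (hr v).resolve_right fun h => hv h.2
  have hidem : ∀ v, r (r v) = r v := by
    intro v
    by_contra h
    have hv : r v ≠ v := fun h' => h (by rw [h', h'])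
    obtain ⟨h1, h2⟩ := hne v hv
    obtain ⟨h3, h4⟩ := hne (r v) h
    -- If `r v` were itself a chosen leaf, its only edge would be `s(v, r v)`, whose chosen leaf is
    -- `v`.
    have := hl' _ h3 _ h1 (by rw [h4]; exact Sym2.mem_mk_right _ _)
    rw [← this, h2] at h4
    exact hv h4.symm
  refine ⟨r, hidem, ?_⟩
  change E = _
  refine (Multiset.Nodup.ext hE (Multiset.Nodup.map_on ?_ (Finset.nodup _))).2 fun e => ?_
  · intro v hv w hw h
    simp only [Finset.mem_val, Finset.mem_filter, Finset.mem_univ, true_and] at hv hw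
    rw [← (hne v hv).2, ← (hne w hw).2, h]
  · simp only [Multiset.mem_map, Finset.mem_val, Finset.mem_filter, Finset.mem_univ, true_and]
    constructor
    · intro he
      have hs := (hr (l e)).resolve_right fun h => h.1 e he rfl
      have := hl' e he _ hs.1 (Sym2.mem_mk_left _ _)
      refine ⟨l e, fun h => hloop _ hs.1 ?_, this⟩
      rw [h]
      exact Sym2.mk_isDiag_iff.2 rfl
    · rintro ⟨v, hv, rfl⟩
      exact (hne v hv).1

/-! ### Reduction to star forests -/

/-- The degree of a vertex (loops count once). -/
def vertexDegree {n : ℕ} (E : EdgeMultiset n) (v : Fin n) : ℕ := E.countP (v ∈ ·)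

/-- The sum of the squares of the degrees. -/
def degreeSquareSum {n : ℕ} (E : EdgeMultiset n) : ℕ := ∑ v, vertexDegree E v ^ 2

theorem degreeSquareSum_le {n : ℕ} (E : EdgeMultiset n) :
    degreeSquareSum E ≤ n * E.card ^ 2 := by
  refine (Finset.sum_le_card_nsmul Finset.univ _ (E.card ^ 2) fun v _ => ?_).trans (by simp)
  exact Nat.pow_le_pow_left (Multiset.countP_le_card _ _) 2

/-- Moving one unit from a smaller entry a to a larger entry b changes the sum of squares by 2(b -
a) + 2. -/
theorem sum_sq_lt_sum_sq_of_transfer {ι : Type*} [Fintype ι] [DecidableEq ι] {A B : ι → ℕ}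
    {v w : ι} (hvw : v ≠ w) (h : ∀ x, x ≠ v → x ≠ w → A x = B x) (hv : A v = B v + 1)
    (hw : B w = A w + 1) (hle : A v ≤ A w) : ∑ x, A x ^ 2 < ∑ x, B x ^ 2 := by
  have key : ∀ f : ι → ℕ, ∑ x, f x = f v + (f w + ∑ x ∈ (Finset.univ.erase v).erase w, f x) := by
    intro f
    rw [Finset.add_sum_erase _ _ (by simp [hvw.symm]), Finset.add_sum_erase _ _ (by simp)]
  rw [key fun x => A x ^ 2, key fun x => B x ^ 2]
  have : ∑ x ∈ (Finset.univ.erase v).erase w, A x ^ 2 =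
      ∑ x ∈ (Finset.univ.erase v).erase w, B x ^ 2 := by
    refine Finset.sum_congr rfl fun x hx => ?_
    simp only [Finset.mem_erase, Finset.mem_univ, and_true] at hx
    rw [h x hx.2 hx.1]
  rw [this]
  rw [hv, hw]
  nlinarith

theorem vertexDegree_add_pair {n : ℕ} (E : EdgeMultiset n) (e f : Sym2 (Fin n)) (x : Fin n) :
    vertexDegree (E + {e, f}) x =
      vertexDegree E x + ((if x ∈ e then 1 else 0) + if x ∈ f then 1 else 0) := by
  rw [vertexDegree, vertexDegree, Multiset.countP_add]
  congr 1
  rw [show ({e, f} : Multiset (Sym2 (Fin n))) = {e} + {f} from rfl, Multiset.countP_add,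
    Multiset.countP_eq_card_filter, Multiset.countP_eq_card_filter, Multiset.filter_singleton,
    Multiset.filter_singleton]
  split_ifs <;> rfl

theorem degreeSquareSum_lt_of_slide {n : ℕ} (E : EdgeMultiset n) {u v w : Fin n} (huv : u ≠ v)
    (hvw : v ≠ w) (huw : u ≠ w)
    (h : vertexDegree (E + {s(u, v), s(v, w)}) v ≤ vertexDegree (E + {s(u, v), s(v, w)}) w) :
    degreeSquareSum (E + {s(u, v), s(v, w)}) < degreeSquareSum (E + {s(u, w), s(v, w)}) := by
  refine sum_sq_lt_sum_sq_of_transfer hvw ?_ ?_ ?_ h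
  · intro x hxv hxw
    rw [vertexDegree_add_pair, vertexDegree_add_pair]
    simp [hxv, hxw]
  · rw [vertexDegree_add_pair, vertexDegree_add_pair]
    simp [huv.symm, hvw, add_assoc]
  · rw [vertexDegree_add_pair, vertexDegree_add_pair]
    simp [huw.symm, hvw.symm, add_assoc]

theorem exists_slide {n : ℕ} {E : EdgeMultiset n} (hE : E.Nodup)
    (hloop : ∀ e ∈ E, ¬ e.IsDiag) (h : ¬ IsStarForest ⟨n, E⟩) :
    ∃ (F : EdgeMultiset n) (u v w : Fin n), u ≠ v ∧ v ≠ w ∧ u ≠ w ∧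
      E = F + {s(u, v), s(v, w)} ∧ vertexDegree E v ≤ vertexDegree E w := by
  have hleaf : ∃ e ∈ E, ∀ v ∈ e, ∃ f ∈ E, v ∈ f ∧ f ≠ e := by
    by_contra hcon
    push Not at hcon
    exact h (isStarForest_of_leaves hE hloop hcon)
  obtain ⟨e, he, hadj⟩ := hleaf
  obtain ⟨v, w, rfl, hvw⟩ : ∃ v w, e = s(v, w) ∧ vertexDegree E v ≤ vertexDegree E w := by
    induction e with
    | _ a b =>
      rcases le_total (vertexDegree E a) (vertexDegree E b) with h | h
      · exact ⟨a, b, rfl, h⟩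
      · exact ⟨b, a, Sym2.eq_swap, h⟩
  obtain ⟨f, hf, ⟨u, rfl⟩, hne⟩ := hadj v (Sym2.mem_mk_left v w)
  obtain ⟨F, rfl⟩ := Multiset.exists_cons_of_mem he
  obtain ⟨F, rfl⟩ := Multiset.exists_cons_of_mem ((Multiset.mem_cons.1 hf).resolve_left hne)
  refine ⟨F, u, v, w, ?_, ?_, ?_, ?_, hvw⟩
  · rintro rfl
    exact hloop _ hf (Sym2.mk_isDiag_iff.2 rfl)
  · rintro rfl
    exact hloop _ he (Sym2.mk_isDiag_iff.2 rfl)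
  · rintro rfl
    exact hne rfl
  · rw [add_comm, Sym2.eq_swap (a := u), Multiset.cons_swap, ← Multiset.singleton_add,
      ← Multiset.singleton_add, ← add_assoc]
    rfl

section

variable {K : Type*} [Field K]

/-- The span of the relations and of the star forests. -/
noncomputable def starForestSpan (K : Type*) [Field K] : Submodule K[X] (GraphAlgebra K) :=
  relationSpan K ⊔ Submodule.span K[X] {x | ∃ G, IsStarForest G ∧ x = Finsupp.single G 1}

theorem relationSpan_le_starForestSpan : relationSpan K ≤ starForestSpan K := le_sup_left

theorem single_mem_of_single_one_mem {S : Submodule K[X] (GraphAlgebra K)} {G : LabelledGraph}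
    (h : (Finsupp.single G 1 : GraphAlgebra K) ∈ S) (c : K[X]) :
    (Finsupp.single G c : GraphAlgebra K) ∈ S := by
  simpa using S.smul_mem c h

theorem single_mem_starForestSpan {n : ℕ} (E : EdgeMultiset n) :
    (Finsupp.single ⟨n, E⟩ 1 : GraphAlgebra K) ∈ starForestSpan K := by
  induction hk : E.card using Nat.strong_induction_on generalizing E with
  | _ k ih =>
  -- The inner induction, at a fixed number of edges, is on the distance of the sum of squared
  -- degrees from its upper bound.
  induction hp : n * k ^ 2 - degreeSquareSum E using Nat.strong_induction_on generalizing E with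
  | _ p ihp =>
  subst hk
  have hrel {x : GraphAlgebra K} (hx : x ∈ relationSpan K) := relationSpan_le_starForestSpan hx
  by_cases hloop : ∃ e ∈ E, e.IsDiag
  · obtain ⟨e, he, hd⟩ := hloop
    obtain ⟨E, rfl⟩ := Multiset.exists_cons_of_mem he
    induction e with
    | _ a b =>
      obtain rfl := Sym2.mk_isDiag_iff.1 hd
      rw [← Multiset.singleton_add, add_comm]
      have h1 := single_mem_of_single_one_mem (ih _ (by simp) E rfl) (X + 1)
      simpa using add_mem (hrel (loop_mem_relationSpan E a)) h1
  by_cases hE : E.Nodup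
  · push Not at hloop
    by_cases hstar : IsStarForest ⟨n, E⟩
    · exact Submodule.mem_sup_right (Submodule.subset_span ⟨_, hstar, rfl⟩)
    obtain ⟨F, u, v, w, huv, hvw, huw, rfl, hdeg⟩ := exists_slide hE hloop hstar
    have h1 := ih _ (by simp) (F + {s(u, w)}) rfl
    have h2 := ih _ (by simp) (F + {s(u, v)}) rfl
    have hlt := degreeSquareSum_lt_of_slide F huv hvw huw hdeg
    -- The bound ensures that the truncated difference really drops.
    have hle := degreeSquareSum_le (F + {s(u, w), s(v, w)})
    have hcard : (F + {s(u, w), s(v, w)}).card = (F + {s(u, v), s(v, w)}).card := by simp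
    rw [hcard] at hle
    have h3 := ihp _ (by omega) (F + {s(u, w), s(v, w)}) hcard rfl
    have h4 := add_mem (sub_mem (add_mem (hrel (slide_mem_relationSpan F huv hvw huw)) h3) h1) h2
    convert h4 using 1
    abel
  · rw [Multiset.nodup_iff_ne_cons_cons] at hE
    push Not at hE
    obtain ⟨e, E, rfl⟩ := hE
    induction e with
    | _ u v =>
      have huv : u ≠ v := fun h => hloop ⟨s(u, v), by simp, Sym2.mk_isDiag_iff.2 h⟩
      have h1 := single_mem_of_single_one_mem (ih _ (by simp) (E + {s(u, v)}) rfl) (X + 2)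
      have h2 := single_mem_of_single_one_mem (ih _ (by simp) E rfl) (X + 1)
      have h3 := sub_mem (add_mem (hrel (multi_mem_relationSpan E huv)) h1) h2
      have h4 : s(u, v) ::ₘ s(u, v) ::ₘ E = E + {s(u, v), s(u, v)} := by
        rw [add_comm, ← Multiset.singleton_add, ← Multiset.singleton_add, ← add_assoc]
        rfl
      rw [h4]
      convert h3 using 1
      abel

theorem starForestSpan_eq_top : starForestSpan K = ⊤ := by
  refine eq_top_iff.2 fun x _ => ?_
  induction x using Finsupp.induction_linear with
  | zero => exact zero_mem _
  | add f g hf hg => exact add_mem (hf trivial) (hg trivial)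
  | single G c => exact single_mem_of_single_one_mem (single_mem_starForestSpan G.edges) c

/-- Modulo the relations, every element is a combination of pairwise non-isomorphic star
forests. -/
theorem exists_sub_mem_relationSpan (x : GraphAlgebra K) :
    ∃ y : GraphAlgebra K, x - y ∈ relationSpan K ∧ (∀ G ∈ y.support, IsStarForest G) ∧
      ∀ G ∈ y.support, ∀ H ∈ y.support, G.Isomorphic H → G = H := by
  classical
  -- A representative of minimal support is taken; two isomorphic graphs in it could be merged,
  -- shrinking the support.
  have hex : ∃ k, ∃ y : GraphAlgebra K, x - y ∈ relationSpan K ∧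
      (∀ G ∈ y.support, IsStarForest G) ∧ y.support.card = k := by
    have hx : x ∈ starForestSpan K := by simp [starForestSpan_eq_top]
    obtain ⟨z, hz, y, hy, rfl⟩ := Submodule.mem_sup.1 hx
    refine ⟨_, y, by simpa using hz, ?_, rfl⟩
    have : y ∈ Finsupp.supported K[X] K[X] {G | IsStarForest G} := by
      refine Submodule.span_le.2 ?_ hy
      rintro _ ⟨G, hG, rfl⟩
      exact Finsupp.single_mem_supported K[X] 1 hG
    exact fun G hG => this hG
  obtain ⟨y, hxy, hy, hcard⟩ := Nat.find_spec hex
  refine ⟨y, hxy, hy, fun G hG H hH hGH => ?_⟩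
  by_contra hne
  set z : GraphAlgebra K := y - (Finsupp.single G (y G) - Finsupp.single H (y G)) with hz
  have hsub : z.support ⊆ y.support.erase G := by
    intro F hF
    rw [Finset.mem_erase]
    constructor
    · rintro rfl
      simp [hz, Ne.symm hne] at hF
    · by_contra hF'
      have h1 : F ≠ G := by rintro rfl; exact hF' hG
      have h2 : F ≠ H := by rintro rfl; exact hF' hH
      rw [Finsupp.notMem_support_iff] at hF'
      simp [hz, h1.symm, h2.symm, hF'] at hF
  have hlt : z.support.card < y.support.card :=
    (Finset.card_le_card hsub).trans_lt (Finset.card_erase_lt_of_mem hG)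
  refine Nat.find_min hex (lt_of_lt_of_eq hlt hcard) ⟨z, ?_, fun F hF =>
    hy F (Finset.mem_of_mem_erase (hsub hF)), rfl⟩
  have := add_mem hxy (single_sub_single_mem_relationSpan (K := K) hGH (y G))
  convert this using 1
  rw [hz]
  abel

end

/-! ### Star forests are determined by their monochromatic colorings -/

theorem colorWeight_apply {n : ℕ} (κ : Fin n → ℕ) (c : ℕ) :
    colorWeight κ c = (Finset.univ.filter fun v => κ v = c).card := by
  simp [colorWeight, Finsupp.finsetSum_apply, Finsupp.single_apply]

theorem card_roots_of_color {n : ℕ} {r : Fin n → Fin n} (hr : ∀ v, r (r v) = r v)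
    {κ : Fin n → ℕ} (hκ : ∀ v, κ (r v) = κ v)
    (hinj : Set.InjOn κ {v | r v = v}) (c : ℕ) :
    (Finset.univ.filter fun v => κ v = c ∧ r v = v).card =
      if colorWeight κ c = 0 then 0 else 1 := by
  rw [colorWeight_apply]
  split_ifs with h
  · rw [Finset.card_eq_zero, Finset.filter_eq_empty_iff] at h ⊢
    exact fun v hv h' => h hv h'.1
  · obtain ⟨v, hv⟩ := Finset.card_pos.1 (Nat.pos_of_ne_zero h)
    rw [Finset.mem_filter] at hv
    rw [Finset.card_eq_one]
    refine ⟨r v, Finset.eq_singleton_iff_unique_mem.2 ⟨?_, fun w hw => ?_⟩⟩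
    · simp [hκ, hv.2, hr]
    · rw [Finset.mem_filter] at hw
      refine hinj hw.2.2 (hr v) ?_
      rw [hw.2.1, hκ, hv.2]

/-- When each color class is exactly one star, the weight lists the star sizes, and these determine
the star forest. -/
theorem exists_equiv_of_colorWeight_eq {m n : ℕ} {r : Fin m → Fin m} {r' : Fin n → Fin n}
    (hr : ∀ v, r (r v) = r v) (hr' : ∀ v, r' (r' v) = r' v)
    {κ : Fin m → ℕ} {κ' : Fin n → ℕ} (hκ : ∀ v, κ (r v) = κ v) (hκ' : ∀ v, κ' (r' v) = κ' v)
    (hinj : Set.InjOn κ {v | r v = v}) (hinj' : Set.InjOn κ' {v | r' v = v})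
    (h : colorWeight κ = colorWeight κ') :
    ∃ f : Fin m ≃ Fin n, ∀ v, r' (f v) = f (r v) := by
  -- Vertices are matched by color and by being a centre or not.
  have hcard : ∀ c : ℕ × Bool, Nonempty ({v // (κ v, decide (r v = v)) = c} ≃
      {v // (κ' v, decide (r' v = v)) = c}) := by
    rintro ⟨c, b⟩
    refine Fintype.card_eq.1 ?_
    rw [Fintype.card_subtype, Fintype.card_subtype]
    have h1 := card_roots_of_color hr hκ hinj c
    have h2 := card_roots_of_color hr' hκ' hinj' c
    rw [← h] at h2
    cases b with
    | true => simpa [h1] using h2.symm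
    | false =>
      have h3 := colorWeight_apply κ c
      have h4 := colorWeight_apply κ' c
      rw [← Finset.card_filter_add_card_filter_not (fun v => r v = v), Finset.filter_filter,
        Finset.filter_filter, h1] at h3
      rw [← Finset.card_filter_add_card_filter_not (fun v => r' v = v), Finset.filter_filter,
        Finset.filter_filter, h2, ← h] at h4
      simpa using Nat.add_left_cancel (h3.symm.trans h4)
  let f : Fin m ≃ Fin n := Equiv.ofFiberEquiv fun c => (hcard c).some
  have hf : ∀ v, κ' (f v) = κ v ∧ (r' (f v) = f v ↔ r v = v) := by
    intro v
    have : (κ' (f v), decide (r' (f v) = f v)) = (κ v, decide (r v = v)) :=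
      Equiv.ofFiberEquiv_map (fun c => (hcard c).some) v
    rwa [Prod.mk.injEq, decide_eq_decide] at this
  -- Both sides are centres of the same color, hence equal.
  refine ⟨f, fun v => hinj' (hr' _) ((hf _).2.2 (hr v)) ?_⟩
  rw [hκ', (hf _).1, (hf _).1, hκ]

/-- A coloring constant on the stars of `G` uses at most one color per star, and here it uses as
many colors as `H` has stars. As `G` has no more stars than `H`, each star gets its own color. -/
theorem isomorphic_of_monochromatic {G H : LabelledGraph} (hG : IsStarForest G)
    {r' : Fin H.order → Fin H.order} (hr' : ∀ v, r' (r' v) = r' v)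
    (hH : H.edges = (Finset.univ.filter fun v => r' v ≠ v).val.map fun v => s(v, r' v))
    (hle : G.order - G.edges.card ≤ H.order - H.edges.card) {κ : Fin G.order → ℕ}
    (hκ : monoCount G.edges κ = G.edges.card)
    (hw : colorWeight κ = colorWeight fun v => (r' v : ℕ)) : G.Isomorphic H := by
  classical
  obtain ⟨m, E⟩ := G
  obtain ⟨n, F⟩ := H
  obtain ⟨r, hr, hE⟩ := hG
  simp only at *
  -- In a star forest, vertices minus edges is the number of centres, so `hle` compares numbers of
  -- stars.
  have hcard : ∀ (k : ℕ) (s : Fin k → Fin k),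
      k - ((Finset.univ.filter fun v => s v ≠ v).val.map fun v => s(v, s v)).card =
        (Finset.univ.filter fun v => s v = v).card := by
    intro k s
    have := Finset.card_filter_add_card_filter_not (s := Finset.univ) (fun v => s v = v)
    rw [Finset.card_fin] at this
    rw [Multiset.card_map, Finset.card_val]
    simp only [ne_eq]
    omega
  have hmono : ∀ v, κ (r v) = κ v := by
    intro v
    by_cases hv : r v = v
    · rw [hv]
    · have := Multiset.countP_eq_card.1 hκ s(v, r v)
        (by rw [hE]; exact Multiset.mem_map_of_mem _ (by simpa using hv))
      rw [Sym2.map_mk, Sym2.mk_isDiag_iff] at this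
      exact this.symm
  have hinj' : Set.InjOn (fun v => (r' v : ℕ)) {v | r' v = v} := by
    intro v hv w hw h
    have hv : r' v = v := hv
    have hw : r' w = w := hw
    rw [← hv, ← hw]
    exact Fin.ext h
  have hinj : Set.InjOn κ {v | r v = v} := by
    have hsub : (Finset.univ.filter fun v => r' v = v).image (fun v => (r' v : ℕ)) ⊆
        (Finset.univ.filter fun v => r v = v).image κ := by
      intro c hc
      obtain ⟨w, hw', rfl⟩ := Finset.mem_image.1 hc
      have h0 : colorWeight κ (r' w : ℕ) ≠ 0 := by
        rw [hw, colorWeight_apply]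
        exact (Finset.card_pos.2 ⟨w, by simp⟩).ne'
      rw [colorWeight_apply] at h0
      obtain ⟨v, hv⟩ := Finset.card_pos.1 (Nat.pos_of_ne_zero h0)
      refine Finset.mem_image.2 ⟨r v, by simp [hr], ?_⟩
      rw [hmono]
      exact (Finset.mem_filter.1 hv).2
    have h1 := Finset.card_le_card hsub
    rw [Finset.card_image_of_injOn (by simpa using hinj')] at h1
    rw [hE, hH, hcard, hcard] at hle
    have := Finset.card_image_iff.1 (le_antisymm Finset.card_image_le (hle.trans h1))
    simpa using this
  obtain ⟨f, hf⟩ := exists_equiv_of_colorWeight_eq hr hr' hmono (fun v => by rw [hr']) hinj hinj' hw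
  have hFE : F = E.map (Sym2.map f) := by
    have himg : (Finset.univ.filter fun v => r' v ≠ v) =
        (Finset.univ.filter fun v => r v ≠ v).map f.toEmbedding := by
      ext v
      obtain ⟨w, rfl⟩ := f.surjective v
      simp [hf]
    rw [hH, hE, himg, Finset.map_val, Multiset.map_map, Multiset.map_map]
    refine Multiset.map_congr rfl fun v _ => ?_
    simp [hf]
  rw [hFE]
  exact LabelledGraph.isomorphic_map E f

/-! ### Linear independence -/

section

variable {K : Type*} [Field K]

theorem natDegree_coeff_xbSeries_le (G : LabelledGraph) (m : ℕ →₀ ℕ) :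
    (MvPowerSeries.coeff m (G.xbSeries K)).natDegree ≤ G.edges.card := by
  rw [LabelledGraph.coeff_xbSeries]
  refine natDegree_sum_le_of_forall_le _ _ fun κ _ => ?_
  refine natDegree_pow_le_of_le _ (m := 1) ?_ |>.trans ?_
  · compute_degree
  · rw [mul_one]
    exact Multiset.countP_le_card _ _

/-- Each summand is a power of 1 + t with exponent at most |E(G)|, and only the full exponent
reaches the top degree. -/
theorem coeff_card_coeff_xbSeries (G : LabelledGraph) (m : ℕ →₀ ℕ) :
    (MvPowerSeries.coeff m (G.xbSeries K)).coeff G.edges.card =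
      ((coloringsOf G.order m).filter fun κ => monoCount G.edges κ = G.edges.card).card := by
  rw [LabelledGraph.coeff_xbSeries, finsetSum_coeff, Finset.card_filter, Nat.cast_sum]
  refine Finset.sum_congr rfl fun κ _ => ?_
  rw [coeff_one_add_X_pow, badEdges_eq_monoCount]
  have : monoCount G.edges κ ≤ G.edges.card := Multiset.countP_le_card _ _
  split_ifs with h
  · rw [h, Nat.choose_self]
  · rw [Nat.choose_eq_zero_of_lt (lt_of_le_of_ne this h)]

/-- Pairwise non-isomorphic star forests have linearly independent Tutte symmetric functions. -/
theorem eq_zero_of_mem_ker [CharZero K] {y : GraphAlgebra K} (hy : y ∈ LinearMap.ker (XB K))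
    (hstar : ∀ G ∈ y.support, IsStarForest G)
    (hiso : ∀ G ∈ y.support, ∀ H ∈ y.support, G.Isomorphic H → G = H) : y = 0 := by
  by_contra hne
  obtain ⟨H, hHs, hmax⟩ := Finset.exists_max_image y.support
    (fun G => toLex ((y G).natDegree + G.edges.card, G.order - G.edges.card))
    (Finsupp.support_nonempty_iff.2 hne)
  obtain ⟨r, hr, hH⟩ := hstar H hHs
  -- Each vertex of `H` is colored by the index of its centre, so the exponents of `m` are the star
  -- sizes.
  set m := colorWeight fun v => (r v : ℕ) with hm
  have hzero := congrArg (fun p => coeff p ((y H).natDegree + H.edges.card))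
    (mem_ker_XB_iff.1 hy m)
  have hcoeff : ∀ G : LabelledGraph,
      (y G * MvPowerSeries.coeff m (G.xbSeries K)).coeff ((y G).natDegree + G.edges.card) =
      (y G).leadingCoeff *
        ((coloringsOf G.order m).filter fun κ => monoCount G.edges κ = G.edges.card).card := by
    intro G
    rw [coeff_mul_add_eq_of_natDegree_le le_rfl (natDegree_coeff_xbSeries_le G m),
      coeff_card_coeff_xbSeries]
    rfl
  simp only [Finsupp.sum, finsetSum_coeff, coeff_zero] at hzero
  rw [Finset.sum_eq_single H, hcoeff] at hzero
  · rcases mul_eq_zero.1 hzero with h | h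
    · exact Finsupp.mem_support_iff.1 hHs (leadingCoeff_eq_zero.1 h)
    · rw [Nat.cast_eq_zero, Finset.card_eq_zero, Finset.filter_eq_empty_iff] at h
      refine h (mem_coloringsOf.2 hm.symm) (Multiset.countP_eq_card.2 fun e he => ?_)
      rw [hH] at he
      obtain ⟨v, _, rfl⟩ := Multiset.mem_map.1 he
      rw [Sym2.map_mk, Sym2.mk_isDiag_iff, hr]
  · intro G hGs hGH
    have hle := Prod.Lex.le_iff.1 (hmax G hGs)
    simp only [ofLex_toLex] at hle
    -- Either the term of `G` has too small a degree in t, or degrees tie and `G` has at most as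
    -- many stars as `H`.
    rcases hle with hlt | ⟨heq, hle⟩
    · refine coeff_eq_zero_of_natDegree_lt (natDegree_mul_le.trans_lt ?_)
      have := natDegree_coeff_xbSeries_le (K := K) G m
      omega
    · rw [← heq, hcoeff]
      convert mul_zero _
      rw [Nat.cast_eq_zero, Finset.card_eq_zero, Finset.filter_eq_empty_iff]
      intro κ hκ hmono
      exact hGH (hiso G hGs H hHs (isomorphic_of_monochromatic (hstar G hGs) hr hH hle hmono
        (mem_coloringsOf.1 hκ)))
  · exact fun h => absurd hHs h

end

theorem theorem3 (K : Type*) [Field K] [CharZero K] :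
    Submodule.span K[X] (TIso K) ⊔ Submodule.span K[X] (TLoop K ∪ TMulti K) ⊔
      Submodule.span K[X] (TOSPlus K) = LinearMap.ker (XB K) := by
  refine le_antisymm (relationSpan_le_ker K) fun x hx => ?_
  obtain ⟨y, hxy, hstar, hiso⟩ := exists_sub_mem_relationSpan x
  have hy : y ∈ LinearMap.ker (XB K) := by
    simpa using sub_mem hx (relationSpan_le_ker K hxy)
  rw [eq_zero_of_mem_ker hy hstar hiso, sub_zero] at hxy
  exact hxy
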